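/- Let $D=\{(x,y)\in\mathbb{R}^2 : x>0\}$. Let $X_0(x)=\tfrac52+\sum_{k\ge1}a_kx^{2k}$, where $a_1=1$ and $2(k+1)(4k^2+\tfrac54)a_{k+1}+(2k-1)a_k=0$ for $k\ge1$, and put $h(x,y)=2X_0-xX_0'+y^2\,X_0'/x+\sqrt5$. On $D$ define $$a_1=\tfrac{2y}{xh}\big(X_0+\tfrac{\sqrt5}{2}\big),\quad b_1=-\tfrac{1}{xh}\big(X_0+\tfrac{\sqrt5}{2}+\sqrt5(x^2-y^2)\big),\quad c_1=-\tfrac{2}{xh}\big(X_0+\tfrac{\sqrt5}{2}\big),$$ $$a_2=-\tfrac1h\big(2X_0+\sqrt5-(x^2+y^2)\tfrac{X_0'}{x}\big),\quad b_2=-\tfrac{2y}{h}\big(\tfrac{X_0'}{2x}+\sqrt5\big),\quad c_2=\tfrac{2y}{h}\big(X_0''-\tfrac{X_0'}{x}\big)$$ (here $a_1,a_2$ denote functions on $D$, not the coefficients of the series), and $$\Omega_1=\begin{bmatrix}0&a_1&0&0\\-a_1&0&c_1&b_1\\0&-c_1&0&0\\0&-b_1&0&0\end{bmatrix},\qquad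 \Omega_2=\begin{bmatrix}0&0&a_2&0\\0&0&-c_2&0\\-a_2&c_2&0&b_2\\0&0&-b_2&0\end{bmatrix},\qquad \Omega=\Omega_1\,dx+\Omega_2\,dy .$$ A frame field on $D$ is an analytic field $F^0=[\phi,X^0_\alpha,X^0_\beta,\xi]$ of orthonormal frames of $\mathbb{R}^4$ (the four vectors being the columns of $F^0$) with $dF^0=F^0\Omega$ on $D$. A curvature surface determined by $F^0$ is an analytic map $f^0:D\to\mathbb{R}^4$ with $$df^0=\frac{x^2-y^2}{x\,h}\,X^0_\alpha\,dx+\frac{2y}{h}\,X^0_\beta\,dy .$$ Let $B_2(x)=-\tfrac12 X_0'/x-\sqrt5$ and $C_2(x)=X_0''-X_0'/x$. **Corollary.** Let $f^0$ be a curvature surface on $D$ determined by the frame field $F^0$, normalised so that $f^0(x_0,0)=0$ and $F^0(x_0,0)=\mathrm{Id}$ for some $x_0>0$. Let $B=\mathrm{diag}(-1,1,1,1)$. Then for all $(x,y)\in D$ $$B f^0(x,y)=f^0(x,-y),\qquad B\phi(x,y)=-\phi(x,-y),\qquad B\xi(x,y)=\xi(x,-y).$$ Furthermore, there are functions $\tilde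 u,\tilde A:(0,\infty)\to\mathbb{R}^4$ (necessarily unique) such that for all $(x,y)\in D$ $$\tilde u(x)=(B_2^2+C_2^2)^{-1/2}(x)\,\big(-B_2X^0_\alpha+C_2\xi\big)(x,y),\qquad f^0(x,y)=(B_2^2+C_2^2)^{-1/2}(x)\,\tilde f(x,y)+\tilde A(x),$$ where $\tilde f(x,y)=(B_2^2+C_2^2)^{-1/2}(x)\,(B_2\xi+C_2X^0_\alpha)(x,y)$. Here $\|\tilde u(x)\|=1$, and each $y$-curve $y\mapsto f^0(x,y)$ lies on the $2$-sphere with centre $\tilde A(x)$ and radius $(B_2^2+C_2^2)^{-1/2}(x)$ in the affine hyperplane through $\tilde A(x)$ perpendicular to $\tilde u(x)$. The reflection fixes both: $B\tilde u(x)=\tilde u(x)$ and $B\tilde A(x)=\tilde A(x)$ for all $x>0$. -/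

import Mathlib

open scoped Matrix

noncomputable section

/-- The Euclidean space `ℝ⁴`. -/
abbrev E4 : Type := EuclideanSpace ℝ (Fin 4)

/-- The coefficients of the generalized hypergeometric series `X₀`, shifted by one:
`x0Coeff n` is `a_{n+1}`, where `a_1 = 1` and
`2 (k + 1) (4 k² + 5/4) a_{k+1} + (2 k - 1) a_k = 0` for `k ≥ 1`. -/
def x0Coeff : ℕ → ℝ
  | 0 => 1
  | n + 1 => -((2 * ((n : ℝ) + 1) - 1) /
      (2 * (((n : ℝ) + 1) + 1) * (4 * ((n : ℝ) + 1) ^ 2 + 5 / 4))) * x0Coeff n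

/-- `X₀(x) = 5/2 + ∑_{k ≥ 1} a_k x^{2k} = 5/2 + x² - x⁴/21 + ⋯`. -/
def X0 (x : ℝ) : ℝ := 5 / 2 + ∑' n : ℕ, x0Coeff n * x ^ (2 * (n + 1))

/-- `X₀'`. -/
def X0' (x : ℝ) : ℝ := deriv X0 x

/-- `X₀''`. -/
def X0'' (x : ℝ) : ℝ := deriv X0' x

/-- `h(x, y) = 2 X₀ - x X₀' + y² (X₀' / x) + √5`. -/
def hFun (x y : ℝ) : ℝ := 2 * X0 x - x * X0' x + y ^ 2 * (X0' x / x) + √5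

/-- The half plane `D = {(x, y) | x > 0}`. -/
def halfPlane : Set (ℝ × ℝ) := {p | 0 < p.1}

def a1 (x y : ℝ) : ℝ := 2 * y / (x * hFun x y) * (X0 x + √5 / 2)

def b1 (x y : ℝ) : ℝ := -1 / (x * hFun x y) * (X0 x + √5 / 2 + √5 * (x ^ 2 - y ^ 2))

def c1 (x y : ℝ) : ℝ := -2 / (x * hFun x y) * (X0 x + √5 / 2)

def a2 (x y : ℝ) : ℝ := -1 / hFun x y * (2 * X0 x + √5 - (x ^ 2 + y ^ 2) * (X0' x / x))

def b2 (x y : ℝ) : ℝ := -2 * y / hFun x y * (X0' x / (2 * x) + √5)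

def c2 (x y : ℝ) : ℝ := 2 * y / hFun x y * (X0'' x - X0' x / x)

/-- The `dx`-part of the connection form `Ω = Ω₁ dx + Ω₂ dy`. -/
def Omega1 (x y : ℝ) : Matrix (Fin 4) (Fin 4) ℝ :=
  !![0, a1 x y, 0, 0;
     -a1 x y, 0, c1 x y, b1 x y;
     0, -c1 x y, 0, 0;
     0, -b1 x y, 0, 0]

/-- The `dy`-part of the connection form `Ω = Ω₁ dx + Ω₂ dy`. -/
def Omega2 (x y : ℝ) : Matrix (Fin 4) (Fin 4) ℝ :=
  !![0, 0, a2 x y, 0;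
     0, 0, -c2 x y, 0;
     -a2 x y, c2 x y, 0, b2 x y;
     0, 0, -b2 x y, 0]

/-- The vector fields `φ`, `X_α`, `X_β`, `ξ` are the columns `0, 1, 2, 3` of
`F = [φ, X_α, X_β, ξ]`. -/
def col (F : ℝ → ℝ → Matrix (Fin 4) (Fin 4) ℝ) (j : Fin 4) (x y : ℝ) : E4 :=
  WithLp.toLp 2 (fun i => F x y i j)

def phi (F : ℝ → ℝ → Matrix (Fin 4) (Fin 4) ℝ) : ℝ → ℝ → E4 := col F 0

def Xalpha (F : ℝ → ℝ → Matrix (Fin 4) (Fin 4) ℝ) : ℝ → ℝ → E4 := col F 1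

def Xbeta (F : ℝ → ℝ → Matrix (Fin 4) (Fin 4) ℝ) : ℝ → ℝ → E4 := col F 2

def xi (F : ℝ → ℝ → Matrix (Fin 4) (Fin 4) ℝ) : ℝ → ℝ → E4 := col F 3

/-- `F` is, on `D`, an analytic field of orthonormal frames of `ℝ⁴` solving the structure
equation `dF = F Ω`, written entrywise. The values of `F` off `D` are irrelevant. -/
structure IsFrameField (F : ℝ → ℝ → Matrix (Fin 4) (Fin 4) ℝ) : Prop where
  analytic : ∀ i j, AnalyticOnNhd ℝ (fun p : ℝ × ℝ => F p.1 p.2 i j) halfPlane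
  orthonormal : ∀ x y, 0 < x → F x y ∈ Matrix.orthogonalGroup (Fin 4) ℝ
  deriv_x : ∀ x y, 0 < x → ∀ i j,
    HasDerivAt (fun t => F t y i j) ((F x y * Omega1 x y) i j) x
  deriv_y : ∀ x y, 0 < x → ∀ i j,
    HasDerivAt (fun t => F x t i j) ((F x y * Omega2 x y) i j) y

/-- `f` is, on `D`, a curvature surface determined by the frame field `F`: an analytic map with
`df = ((x² - y²) / (x h)) X_α dx + (2 y / h) X_β dy`. -/
structure IsCurvatureSurface (F : ℝ → ℝ → Matrix (Fin 4) (Fin 4) ℝ) (f : ℝ → ℝ → E4) :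
    Prop where
  frame : IsFrameField F
  analytic : AnalyticOnNhd ℝ (fun p : ℝ × ℝ => f p.1 p.2) halfPlane
  deriv_x : ∀ x y, 0 < x →
    HasDerivAt (fun t => f t y) (((x ^ 2 - y ^ 2) / (x * hFun x y)) • Xalpha F x y) x
  deriv_y : ∀ x y, 0 < x →
    HasDerivAt (fun t => f x t) ((2 * y / hFun x y) • Xbeta F x y) y

/-- `B₂(x) = -(1/2) (X₀'/x) - √5`. -/
def B2 (x : ℝ) : ℝ := -(1 / 2) * (X0' x / x) - √5

/-- `C₂(x) = X₀'' - X₀'/x`. -/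
def C2 (x : ℝ) : ℝ := X0'' x - X0' x / x

/-- The radius `(B₂² + C₂²)^{-1/2}(x)` of the sphere containing the `y`-curve. -/
def radius (x : ℝ) : ℝ := (√(B2 x ^ 2 + C2 x ^ 2))⁻¹

/-- The vector `(B₂² + C₂²)^{-1/2}(x) (-B₂ X_α + C₂ ξ)(x, y)`. -/
def uVec (F : ℝ → ℝ → Matrix (Fin 4) (Fin 4) ℝ) (x y : ℝ) : E4 :=
  radius x • (-B2 x • Xalpha F x y + C2 x • xi F x y)

/-- The vector `(B₂² + C₂²)^{-1/2}(x) (B₂ ξ + C₂ X_α)(x, y)`. -/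
def fVec (F : ℝ → ℝ → Matrix (Fin 4) (Fin 4) ℝ) (x y : ℝ) : E4 :=
  radius x • (B2 x • xi F x y + C2 x • Xalpha F x y)

/-- The reflection `B = diag(-1, 1, 1, 1)` of `ℝ⁴`. -/
def reflB : E4 →ₗ[ℝ] E4 :=
  Matrix.toEuclideanLin (Matrix.diagonal ![(-1 : ℝ), 1, 1, 1])

end

/-! The parities in y of the coefficients of Ω make B F(x,-y) B a solution of the same linear system
as F, with the same value at (x₀,0). Since Ω is skew, (B F(x,-y) B) F(x,y)ᵀ is constant, so the two
solutions agree (`reflected`); integrating df carries the symmetry over to f (`reflB_eq`). The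
y-derivatives of X_α, ξ and f are C₂, B₂ and 1 times the same vector (2y/h) X_β. Hence ũ and the
centre Ã do not depend on y (`uVec_eq`, `sub_radius_smul_fVec_eq`), and at y = 0 the reflection
visibly fixes them. The series X₀ enters only to show B₂ ≠ 0, without which the radius would be the
default value 0. A first integral of the differential equation of X₀ gives X₀'/x > 0 (`slope_pos`),
hence B₂ < 0. -/

/-! ### Everywhere convergent power series -/

/-- The coefficient sequence `c` defines an everywhere convergent power series. -/
def EntireCoeff (c : ℕ → ℝ) : Prop := ∀ R : ℝ, Summable fun n => c n * R ^ n

theorem EntireCoeff.of_le {c d : ℕ → ℝ} (hc : EntireCoeff c)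
    (h : ∀ n, |d n| ≤ |c n| * 2 ^ n) : EntireCoeff d := by
  intro R
  refine Summable.of_norm_bounded (hc (2 * |R|)).abs fun n => ?_
  rw [Real.norm_eq_abs, abs_mul, abs_mul, abs_pow, abs_pow, abs_mul, abs_abs, mul_pow,
    abs_of_pos (two_pos : (0 : ℝ) < 2), ← mul_assoc]
  exact mul_le_mul_of_nonneg_right (h n) (by positivity)

theorem EntireCoeff.index_mul {c : ℕ → ℝ} (hc : EntireCoeff c) :
    EntireCoeff fun n => (n : ℝ) * c n := by
  refine hc.of_le fun n => ?_
  rw [abs_mul, mul_comm, Nat.abs_cast]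
  have : (n : ℝ) ≤ 2 ^ n := by exact_mod_cast (Nat.lt_two_pow_self (n := n)).le
  gcongr

theorem EntireCoeff.succ {c : ℕ → ℝ} (hc : EntireCoeff c) :
    EntireCoeff fun n => c (n + 1) := by
  intro R
  refine Summable.of_norm_bounded
    ((summable_nat_add_iff 1).2 (hc (|R| + 1)).abs) fun n => ?_
  rw [Real.norm_eq_abs, abs_mul, abs_mul, abs_pow, abs_pow, abs_of_pos (by positivity : 0 < |R| + 1)]
  gcongr ?_ * ?_
  calc |R| ^ n ≤ (|R| + 1) ^ n := by gcongr; linarith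
    _ ≤ (|R| + 1) ^ (n + 1) :=
      pow_le_pow_right₀ (by linarith [abs_nonneg R]) (Nat.le_succ n)

/-- The sum of the power series with coefficients `c`. -/
noncomputable def powerSum (c : ℕ → ℝ) (t : ℝ) : ℝ := ∑' n, c n * t ^ n

/-- The coefficients of the derivative of a power series. -/
def derivCoeff (c : ℕ → ℝ) (n : ℕ) : ℝ := ((n + 1 : ℕ) : ℝ) * c (n + 1)

theorem EntireCoeff.derivative {c : ℕ → ℝ} (hc : EntireCoeff c) :
    EntireCoeff (derivCoeff c) :=
  hc.index_mul.succ

theorem EntireCoeff.hasSum {c : ℕ → ℝ} (hc : EntireCoeff c) (t : ℝ) :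
    HasSum (fun n => c n * t ^ n) (powerSum c t) :=
  (hc t).hasSum

theorem EntireCoeff.mul_powerSum_succ {c : ℕ → ℝ} (hc : EntireCoeff c) (t : ℝ) :
    c 0 + t * powerSum (fun n => c (n + 1)) t = powerSum c t := by
  rw [powerSum, powerSum, (hc t).tsum_eq_zero_add, ← tsum_mul_left, pow_zero, mul_one]
  congr 2
  ext n
  ring

theorem EntireCoeff.mul_powerSum_derivCoeff {c : ℕ → ℝ} (hc : EntireCoeff c) (t : ℝ) :
    t * powerSum (derivCoeff c) t = powerSum (fun n => (n : ℝ) * c n) t := by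
  have h := hc.index_mul.mul_powerSum_succ t
  simp only [Nat.cast_zero, zero_mul, zero_add] at h
  exact h

theorem EntireCoeff.hasDerivAt {c : ℕ → ℝ} (hc : EntireCoeff c) (t : ℝ) :
    HasDerivAt (powerSum c) (powerSum (derivCoeff c) t) t := by
  -- The differentiated series at |t| + 1 dominates it on the whole ball of that radius, which
  -- contains t.
  have hs : Summable fun n : ℕ => |(n : ℝ) * c n * (|t| + 1) ^ (n - 1)| := by
    refine (summable_nat_add_iff 1).1 ?_
    simpa only [Nat.add_sub_cancel, derivCoeff] using (hc.derivative (|t| + 1)).abs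
  have h := hasDerivAt_tsum_of_isPreconnected (t := Metric.ball (0 : ℝ) (|t| + 1))
    (g := fun n s => c n * s ^ n) (g' := fun n s => c n * ((n : ℝ) * s ^ (n - 1)))
    (y₀ := t) (y := t) hs Metric.isOpen_ball
    (convex_ball (0 : ℝ) _).isPreconnected
    (fun n s _ => (hasDerivAt_pow n s).const_mul (c n)) (fun n s hs => ?_)
    (by simp) (hc t) (by simp)
  · refine HasDerivAt.congr_deriv h ?_
    have hs' : Summable fun n => c n * ((n : ℝ) * t ^ (n - 1)) := by
      refine (summable_nat_add_iff 1).1 ((hc.derivative t).congr fun n => ?_)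
      simp only [Nat.add_sub_cancel, derivCoeff]
      ring
    rw [hs'.tsum_eq_zero_add, powerSum]
    simp only [Nat.cast_zero, zero_mul, mul_zero, zero_add, Nat.add_sub_cancel,
      derivCoeff]
    congr 1
    ext n
    ring
  · have hs1 : |s| ≤ |t| + 1 := by
      have := Metric.mem_ball.1 hs
      rw [Real.dist_eq, sub_zero] at this
      exact this.le
    rw [Real.norm_eq_abs, ← mul_assoc, mul_comm (c n), abs_mul, abs_mul _ ((|t| + 1) ^ (n - 1)),
      abs_pow, abs_pow, abs_of_pos (by positivity : 0 < |t| + 1)]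
    gcongr

/-! ### The series X₀ in the variable t = x², and positivity of X₀'/x -/

theorem abs_x0Coeff_le (n : ℕ) : |x0Coeff n| ≤ 1 / (n.factorial : ℝ) := by
  induction n with
  | zero => simp [x0Coeff]
  | succ n ih =>
    have hn : (0 : ℝ) ≤ n := Nat.cast_nonneg n
    rw [x0Coeff, abs_mul, abs_neg, abs_of_nonneg (by
      apply div_nonneg
      · linarith
      · positivity), Nat.factorial_succ, Nat.cast_mul, one_div, mul_inv, ← one_div (n.factorial : ℝ)]
    refine mul_le_mul ?_ ih (abs_nonneg _) (by positivity)
    rw [div_le_iff₀ (by positivity), inv_mul_eq_div, le_div_iff₀ (by positivity)]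
    push_cast
    nlinarith [mul_nonneg hn hn, mul_nonneg hn (mul_nonneg hn hn)]

theorem entireCoeff_x0Coeff : EntireCoeff x0Coeff := by
  intro R
  refine Summable.of_norm_bounded (Real.summable_pow_div_factorial |R|) fun n => ?_
  rw [Real.norm_eq_abs, abs_mul, abs_pow, div_eq_inv_mul, ← one_div]
  exact mul_le_mul_of_nonneg_right (abs_x0Coeff_le n) (by positivity)

/-- The coefficients of `X₀' / x` as a power series in `x²`. -/
noncomputable def slopeCoeff (n : ℕ) : ℝ := 2 * ((n : ℝ) + 1) * x0Coeff n

/-- The coefficients of `X₀` as a power series in `x²`. -/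
noncomputable def x0FullCoeff : ℕ → ℝ
  | 0 => 5 / 2
  | n + 1 => x0Coeff n

theorem entireCoeff_slopeCoeff : EntireCoeff slopeCoeff := by
  intro R
  refine (((entireCoeff_x0Coeff.index_mul R).add (entireCoeff_x0Coeff R)).mul_left 2).congr
    fun n => ?_
  rw [slopeCoeff]
  ring

theorem entireCoeff_x0FullCoeff : EntireCoeff x0FullCoeff := by
  intro R
  refine (summable_nat_add_iff 1).1 (((entireCoeff_x0Coeff R).mul_left R).congr fun n => ?_)
  rw [x0FullCoeff]
  ring

/-- `X₀' / x` as a function of `t = x²`. -/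
noncomputable def slopeSum (t : ℝ) : ℝ := powerSum slopeCoeff t

theorem X0_eq_powerSum (x : ℝ) : X0 x = powerSum x0FullCoeff (x ^ 2) := by
  rw [← entireCoeff_x0FullCoeff.mul_powerSum_succ, X0, powerSum, ← tsum_mul_left, x0FullCoeff]
  congr 2
  ext n
  rw [x0FullCoeff]
  ring

theorem hasDerivAt_powerSum_x0FullCoeff (t : ℝ) :
    HasDerivAt (powerSum x0FullCoeff) (slopeSum t / 2) t := by
  convert entireCoeff_x0FullCoeff.hasDerivAt t using 1
  rw [slopeSum, powerSum, powerSum, ← tsum_div_const]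
  congr 1
  ext n
  rw [slopeCoeff, derivCoeff, x0FullCoeff]
  push_cast
  ring

theorem X0'_eq (x : ℝ) : X0' x = x * slopeSum (x ^ 2) := by
  have h := (hasDerivAt_powerSum_x0FullCoeff (x ^ 2)).comp x (hasDerivAt_pow 2 x)
  have e : X0 = powerSum x0FullCoeff ∘ fun s => s ^ 2 := funext X0_eq_powerSum
  rw [X0', e, h.deriv]
  push_cast
  ring

/-- The coefficients of `t · d/dt (X₀' / x)` in `t = x²`. -/
noncomputable def eulerSlopeCoeff (n : ℕ) : ℝ := (n : ℝ) * slopeCoeff n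

theorem entireCoeff_eulerSlopeCoeff : EntireCoeff eulerSlopeCoeff :=
  entireCoeff_slopeCoeff.index_mul

/-- The recurrence for a_k, read coefficientwise: with W = X₀'/x and Q = tW', it says 4tQ' + (5/4 +
t)W = X₀. -/
theorem slope_equation (t : ℝ) :
    4 * (t * powerSum (derivCoeff eulerSlopeCoeff) t) + (5 / 4 + t) * slopeSum t
      = powerSum x0FullCoeff t := by
  rw [entireCoeff_eulerSlopeCoeff.mul_powerSum_derivCoeff, slopeSum]
  have h1 := (entireCoeff_eulerSlopeCoeff.index_mul.hasSum t).mul_left 4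
  have h2 := (entireCoeff_slopeCoeff.hasSum t).mul_left (5 / 4)
  -- The series of tW, shifted by one so that its index matches the other two.
  have h3 : HasSum (fun n : ℕ => match n with
      | 0 => 0
      | n + 1 => t * (slopeCoeff n * t ^ n)) (t * powerSum slopeCoeff t) := by
    rw [← hasSum_nat_add_iff' 1]
    simpa using (entireCoeff_slopeCoeff.hasSum t).mul_left t
  rw [add_mul, ← add_assoc]
  refine ((h1.add h2).add h3).unique ?_
  refine (entireCoeff_x0FullCoeff.hasSum t).congr_fun fun n => ?_
  cases n with
  | zero => norm_num [eulerSlopeCoeff, slopeCoeff, x0FullCoeff, x0Coeff]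
  | succ n =>
    simp only [eulerSlopeCoeff, slopeCoeff, x0FullCoeff, x0Coeff]
    push_cast
    have : (n : ℝ) + 1 + 1 ≠ 0 := by positivity
    have : 4 * ((n : ℝ) + 1) ^ 2 + 5 / 4 ≠ 0 := by positivity
    field_simp
    ring

/-- Since dX₀/dt = W/2, the derivative reduces by `slope_equation` to 4Q'(tW' - Q) = 0; the constant
is the value at t = 0, where W = 2 and Q = 0. -/
theorem slope_first_integral (t : ℝ) :
    slopeSum t * powerSum x0FullCoeff t - 2 * powerSum eulerSlopeCoeff t ^ 2
      - (5 / 8 + t / 2) * slopeSum t ^ 2 = 5 / 2 := by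
  have hd : ∀ s, HasDerivAt (fun t => slopeSum t * powerSum x0FullCoeff t
      - 2 * powerSum eulerSlopeCoeff t ^ 2 - (5 / 8 + t / 2) * slopeSum t ^ 2) 0 s := by
    intro s
    have hW : HasDerivAt slopeSum (powerSum (derivCoeff slopeCoeff) s) s :=
      entireCoeff_slopeCoeff.hasDerivAt s
    have hQ := entireCoeff_eulerSlopeCoeff.hasDerivAt s
    have hl : HasDerivAt (fun t : ℝ => 5 / 8 + t / 2) (1 / 2) s :=
      ((hasDerivAt_id s).div_const 2).const_add _
    have he : s * powerSum (derivCoeff slopeCoeff) s = powerSum eulerSlopeCoeff s :=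
      entireCoeff_slopeCoeff.mul_powerSum_derivCoeff s
    refine HasDerivAt.congr_deriv (((hW.mul (hasDerivAt_powerSum_x0FullCoeff s)).sub ((hQ.pow 2).const_mul 2)).sub
      (hl.mul (hW.pow 2))) ?_
    rw [← slope_equation s, ← he]
    push_cast
    ring
  have h0 : ∀ c : ℕ → ℝ, EntireCoeff c → powerSum c 0 = c 0 := fun c hc => by
    rw [← hc.mul_powerSum_succ, zero_mul, add_zero]
  have := is_const_of_deriv_eq_zero (fun s => (hd s).differentiableAt) (fun s => (hd s).deriv) t 0
  rw [this, slopeSum, h0 _ entireCoeff_slopeCoeff, h0 _ entireCoeff_x0FullCoeff,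
    h0 _ entireCoeff_eulerSlopeCoeff]
  norm_num [eulerSlopeCoeff, slopeCoeff, x0FullCoeff, x0Coeff]

/-- At a zero of W the first integral would read -2Q² = 5/2, so W keeps the sign of W(0) = 2. -/
theorem slope_pos {t : ℝ} (ht : 0 ≤ t) : 0 < slopeSum t := by
  have h0 : 0 < slopeSum 0 := by
    rw [slopeSum, ← entireCoeff_slopeCoeff.mul_powerSum_succ]
    norm_num [slopeCoeff, x0Coeff]
  by_contra! hneg
  have hc : Continuous slopeSum :=
    continuous_iff_continuousAt.2 fun s => (entireCoeff_slopeCoeff.hasDerivAt s).continuousAt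
  obtain ⟨s, -, hs⟩ := intermediate_value_Icc' ht hc.continuousOn ⟨hneg, h0.le⟩
  have := slope_first_integral s
  rw [hs] at this
  nlinarith [sq_nonneg (powerSum eulerSlopeCoeff s)]

theorem B2_neg {x : ℝ} (hx : 0 < x) : B2 x < 0 := by
  rw [B2, X0'_eq, mul_div_cancel_left₀ _ hx.ne']
  linarith [slope_pos (sq_nonneg x), Real.sqrt_nonneg 5]

theorem B2_sq_add_C2_sq_pos {x : ℝ} (hx : 0 < x) : 0 < B2 x ^ 2 + C2 x ^ 2 :=
  add_pos_of_pos_of_nonneg (sq_pos_of_neg (B2_neg hx)) (sq_nonneg _)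

theorem radius_sq_mul {x : ℝ} (hx : 0 < x) : radius x ^ 2 * (B2 x ^ 2 + C2 x ^ 2) = 1 := by
  rw [radius, inv_pow, Real.sq_sqrt (B2_sq_add_C2_sq_pos hx).le,
    inv_mul_cancel₀ (B2_sq_add_C2_sq_pos hx).ne']

theorem radius_nonneg (x : ℝ) : 0 ≤ radius x := inv_nonneg.2 (Real.sqrt_nonneg _)

/-! ### Functions with vanishing derivatives -/

section Constancy

variable {E : Type*} [NormedAddCommGroup E] [NormedSpace ℝ E]

theorem eq_of_hasDerivAt_zero {g : ℝ → E} (h : ∀ y, HasDerivAt g 0 y) (y y' : ℝ) :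
    g y = g y' :=
  is_const_of_deriv_eq_zero (fun y => (h y).differentiableAt) (fun y => (h y).deriv) y y'

theorem eq_of_partial_derivs_zero {g : ℝ → ℝ → E}
    (hgx : ∀ x y, 0 < x → HasDerivAt (fun t => g t y) 0 x)
    (hgy : ∀ x y, 0 < x → HasDerivAt (fun t => g x t) 0 y)
    {x x₀ : ℝ} (hx : 0 < x) (hx₀ : 0 < x₀) (y y₀ : ℝ) : g x y = g x₀ y₀ := by
  rw [eq_of_hasDerivAt_zero (fun t => hgy x t hx) y y₀]
  exact isOpen_Ioi.is_const_of_deriv_eq_zero (convex_Ioi (0 : ℝ)).isPreconnected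
    (fun t ht => (hgx t y₀ ht).differentiableAt.differentiableWithinAt)
    (fun t ht => (hgx t y₀ ht).deriv) hx hx₀

end Constancy

/-! ### Parity in y of the connection coefficients -/

section Parity

variable (x y : ℝ)

theorem hFun_neg : hFun x (-y) = hFun x y := by rw [hFun, hFun, neg_sq]

theorem a1_neg : a1 x (-y) = -a1 x y := by rw [a1, a1, hFun_neg]; ring

theorem b1_neg : b1 x (-y) = b1 x y := by rw [b1, b1, hFun_neg, neg_sq]

theorem c1_neg : c1 x (-y) = c1 x y := by rw [c1, c1, hFun_neg]

theorem a2_neg : a2 x (-y) = a2 x y := by rw [a2, a2, hFun_neg, neg_sq]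

theorem b2_neg : b2 x (-y) = -b2 x y := by rw [b2, b2, hFun_neg]; ring

theorem c2_neg : c2 x (-y) = -c2 x y := by rw [c2, c2, hFun_neg]; ring

end Parity

/-- The diagonal of the reflection `B`. -/
def reflSign : Fin 4 → ℝ := ![-1, 1, 1, 1]

theorem reflB_apply (v : E4) (i : Fin 4) : reflB v i = reflSign i * v i := by
  simp [reflB, reflSign, Matrix.toLpLin_apply, Matrix.mulVec_diagonal]

theorem b2_eq (x y : ℝ) : b2 x y = 2 * y / hFun x y * B2 x := by
  rw [b2, B2]; ring

theorem c2_eq (x y : ℝ) : c2 x y = 2 * y / hFun x y * C2 x := rfl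

theorem hasDerivAt_euclidean_apply {g : ℝ → E4} {g' : E4} {t : ℝ} (h : HasDerivAt g g' t)
    (i : Fin 4) : HasDerivAt (fun s => g s i) (g' i) t :=
  (EuclideanSpace.proj (𝕜 := ℝ) i).hasFDerivAt.comp_hasDerivAt t h

theorem HasDerivAt.comp_neg' {E : Type*} [NormedAddCommGroup E] [NormedSpace ℝ E]
    {g : ℝ → E} {g' : E} {t : ℝ} (h : HasDerivAt g g' (-t)) :
    HasDerivAt (fun s => g (-s)) (-g') t :=
  (h.scomp t (hasDerivAt_neg t)).congr_deriv (neg_one_smul ℝ g')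

/-! ### Reflection and y-dependence of the frame -/

namespace IsFrameField

variable {F : ℝ → ℝ → Matrix (Fin 4) (Fin 4) ℝ}

/-- Entries of (B F(x,-y) B) F(x,y)ᵀ. Conjugation by B flips exactly a₁ and a₂; a₁ is odd, and in
the dy-part the chain rule's sign compensates the even a₂ and the odd b₂, c₂. -/
theorem sum_reflected_mul (hF : IsFrameField F) {x x₀ : ℝ} (hx : 0 < x) (hx₀ : 0 < x₀)
    (hF₀ : F x₀ 0 = 1) (y : ℝ) (i j : Fin 4) :
    ∑ k, reflSign i * F x (-y) i k * reflSign k * F x y j k = (1 : Matrix (Fin 4) (Fin 4) ℝ) i j := by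
  have h := eq_of_partial_derivs_zero
    (g := fun x y => ∑ k, reflSign i * F x (-y) i k * reflSign k * F x y j k)
    (fun x y hx => ?_) (fun x y hx => ?_) hx hx₀ y 0
  · rw [h, neg_zero, hF₀]
    fin_cases i <;> fin_cases j <;> simp [reflSign, Matrix.one_apply]
  · refine HasDerivAt.congr_deriv (HasDerivAt.fun_sum fun k (_ : k ∈ Finset.univ) =>
      (((hF.deriv_x x (-y) hx i k).const_mul (reflSign i)).mul_const (reflSign k)).mul
        (hF.deriv_x x y hx j k)) ?_
    simp only [Matrix.mul_apply, Fin.sum_univ_four, Omega1, a1_neg, b1_neg, c1_neg, reflSign,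
      Matrix.of_apply, Matrix.cons_val]
    ring
  · refine HasDerivAt.congr_deriv (HasDerivAt.fun_sum fun k (_ : k ∈ Finset.univ) =>
      ((((hF.deriv_y x (-y) hx i k).comp_neg').const_mul (reflSign i)).mul_const
        (reflSign k)).mul (hF.deriv_y x y hx j k)) ?_
    simp only [Matrix.mul_apply, Fin.sum_univ_four, Omega2, a2_neg, b2_neg, c2_neg, reflSign,
      Matrix.of_apply, Matrix.cons_val]
    ring

theorem reflected (hF : IsFrameField F) {x x₀ : ℝ} (hx : 0 < x) (hx₀ : 0 < x₀)
    (hF₀ : F x₀ 0 = 1) (y : ℝ) (i j : Fin 4) :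
    reflSign i * F x (-y) i j * reflSign j = F x y i j := by
  have h : (Matrix.of fun i k => reflSign i * F x (-y) i k * reflSign k) * (F x y)ᵀ = 1 := by
    ext i j
    rw [← hF.sum_reflected_mul hx hx₀ hF₀ y i j]
    simp [Matrix.mul_apply]
  have ho : (F x y)ᵀ * F x y = 1 := (Matrix.mem_orthogonalGroup_iff' _ _).1 (hF.orthonormal x y hx)
  have h' := congrArg (· * F x y) h
  simp only [Matrix.mul_assoc, ho, Matrix.mul_one, Matrix.one_mul] at h'
  exact congrFun (congrFun h' i) j

theorem reflB_col (hF : IsFrameField F) {x x₀ : ℝ} (hx : 0 < x) (hx₀ : 0 < x₀)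
    (hF₀ : F x₀ 0 = 1) (y : ℝ) (j : Fin 4) :
    reflB (col F j x y) = reflSign j • col F j x (-y) := by
  ext i
  rw [reflB_apply]
  change reflSign i * F x y i j = reflSign j * F x (-y) i j
  rw [← hF.reflected hx hx₀ hF₀ y i j]
  have : reflSign i * reflSign i = 1 := by fin_cases i <;> simp [reflSign]
  linear_combination F x (-y) i j * reflSign j * this

theorem inner_col (hF : IsFrameField F) {x : ℝ} (hx : 0 < x) (y : ℝ) (i j : Fin 4) :
    inner ℝ (col F i x y) (col F j x y) = (1 : Matrix (Fin 4) (Fin 4) ℝ) i j := by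
  rw [← (Matrix.mem_orthogonalGroup_iff' _ _).1 (hF.orthonormal x y hx)]
  simp [PiLp.inner_apply, col, Matrix.mul_apply, mul_comm]

theorem reflB_uVec (hF : IsFrameField F) {x x₀ : ℝ} (hx : 0 < x) (hx₀ : 0 < x₀)
    (hF₀ : F x₀ 0 = 1) (y : ℝ) : reflB (uVec F x y) = uVec F x (-y) := by
  simp [uVec, Xalpha, xi, hF.reflB_col hx hx₀ hF₀, reflSign]

theorem reflB_fVec (hF : IsFrameField F) {x x₀ : ℝ} (hx : 0 < x) (hx₀ : 0 < x₀)
    (hF₀ : F x₀ 0 = 1) (y : ℝ) : reflB (fVec F x y) = fVec F x (-y) := by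
  simp [fVec, Xalpha, xi, hF.reflB_col hx hx₀ hF₀, reflSign]

theorem hasDerivAt_Xalpha_y (hF : IsFrameField F) {x : ℝ} (hx : 0 < x) (y : ℝ) (i : Fin 4) :
    HasDerivAt (fun t => Xalpha F x t i) (c2 x y * Xbeta F x y i) y := by
  refine HasDerivAt.congr_deriv (hF.deriv_y x y hx i 1) ?_
  simp [Matrix.mul_apply, Fin.sum_univ_four, Omega2, Xbeta, col, mul_comm]

theorem hasDerivAt_xi_y (hF : IsFrameField F) {x : ℝ} (hx : 0 < x) (y : ℝ) (i : Fin 4) :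
    HasDerivAt (fun t => xi F x t i) (b2 x y * Xbeta F x y i) y := by
  refine HasDerivAt.congr_deriv (hF.deriv_y x y hx i 3) ?_
  simp [Matrix.mul_apply, Fin.sum_univ_four, Omega2, Xbeta, col, mul_comm]

/-- The y-derivative is a multiple of -B₂C₂ + C₂B₂ = 0. -/
theorem uVec_eq (hF : IsFrameField F) {x : ℝ} (hx : 0 < x) (y y' : ℝ) :
    uVec F x y = uVec F x y' := by
  ext i
  refine eq_of_hasDerivAt_zero (g := fun t => uVec F x t i) (fun t => ?_) y y'
  refine HasDerivAt.congr_deriv ((((hF.hasDerivAt_Xalpha_y hx t i).const_mul (-B2 x)).add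
    ((hF.hasDerivAt_xi_y hx t i).const_mul (C2 x))).const_mul (radius x)) ?_
  rw [b2_eq, c2_eq]
  ring

/-- The factor radius²(B₂² + C₂²) = 1 turns this derivative into that of f. -/
theorem hasDerivAt_radius_smul_fVec_y (hF : IsFrameField F) {x : ℝ} (hx : 0 < x) (y : ℝ)
    (i : Fin 4) :
    HasDerivAt (fun t => radius x * fVec F x t i) (2 * y / hFun x y * Xbeta F x y i) y := by
  refine HasDerivAt.congr_deriv (((((hF.hasDerivAt_xi_y hx y i).const_mul (B2 x)).add
    ((hF.hasDerivAt_Xalpha_y hx y i).const_mul (C2 x))).const_mul (radius x)).const_mul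
      (radius x)) ?_
  rw [b2_eq, c2_eq]
  linear_combination (2 * y / hFun x y * Xbeta F x y i) * radius_sq_mul hx

theorem inner_combination (hF : IsFrameField F) {x : ℝ} (hx : 0 < x) (y p q r s : ℝ) :
    inner ℝ (p • Xalpha F x y + q • xi F x y) (r • Xalpha F x y + s • xi F x y)
      = p * r + q * s := by
  simp only [inner_add_left, inner_add_right, real_inner_smul_left, real_inner_smul_right, Xalpha,
    xi, hF.inner_col hx, Matrix.one_apply]
  simp [show (3 : Fin 4) ≠ 1 by decide, show (1 : Fin 4) ≠ 3 by decide]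
  ring

theorem norm_uVec (hF : IsFrameField F) {x : ℝ} (hx : 0 < x) (y : ℝ) : ‖uVec F x y‖ = 1 := by
  rw [← pow_eq_one_iff_of_nonneg (norm_nonneg _) two_ne_zero, ← real_inner_self_eq_norm_sq, uVec,
    real_inner_smul_left, real_inner_smul_right, hF.inner_combination hx]
  linear_combination radius_sq_mul hx

theorem norm_fVec (hF : IsFrameField F) {x : ℝ} (hx : 0 < x) (y : ℝ) : ‖fVec F x y‖ = 1 := by
  rw [← pow_eq_one_iff_of_nonneg (norm_nonneg _) two_ne_zero, ← real_inner_self_eq_norm_sq, fVec,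
    real_inner_smul_left, real_inner_smul_right, add_comm, hF.inner_combination hx]
  linear_combination radius_sq_mul hx

theorem inner_fVec_uVec (hF : IsFrameField F) {x : ℝ} (hx : 0 < x) (y : ℝ) :
    inner ℝ (fVec F x y) (uVec F x y) = 0 := by
  rw [fVec, uVec, real_inner_smul_left, real_inner_smul_right,
    add_comm (B2 x • _), hF.inner_combination hx]
  ring

end IsFrameField

/-! ### Reflection and spherical curves of the surface -/

namespace IsCurvatureSurface

variable {F : ℝ → ℝ → Matrix (Fin 4) (Fin 4) ℝ} {f : ℝ → ℝ → E4}

theorem reflB_eq (hf : IsCurvatureSurface F f) {x x₀ : ℝ} (hx : 0 < x) (hx₀ : 0 < x₀)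
    (hf₀ : f x₀ 0 = 0) (hF₀ : F x₀ 0 = 1) (y : ℝ) : reflB (f x y) = f x (-y) := by
  have hcol : ∀ x y, 0 < x → ∀ i j, reflSign i * F x y i j = reflSign j * F x (-y) i j :=
    fun x y hx i j => by
      have h := congrArg (fun v : E4 => v i) (hf.frame.reflB_col hx hx₀ hF₀ y j)
      simp only [reflB_apply] at h
      exact h
  ext i
  rw [reflB_apply, ← sub_eq_zero]
  have h := eq_of_partial_derivs_zero (g := fun x y => reflSign i * f x y i - f x (-y) i)
    (fun x y hx => ?_) (fun x y hx => ?_) hx hx₀ y 0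
  · rw [h, neg_zero, hf₀]
    simp
  · refine HasDerivAt.congr_deriv (((hasDerivAt_euclidean_apply (hf.deriv_x x y hx) i).const_mul (reflSign i)).sub
      (hasDerivAt_euclidean_apply (hf.deriv_x x (-y) hx) i)) ?_
    have := hcol x y hx i 1
    simp only [PiLp.smul_apply, smul_eq_mul, Xalpha, col, hFun_neg, neg_sq]
    simp only [reflSign, Matrix.cons_val] at this ⊢
    linear_combination ((x ^ 2 - y ^ 2) / (x * hFun x y)) * this
  · refine HasDerivAt.congr_deriv (((hasDerivAt_euclidean_apply (hf.deriv_y x y hx) i).const_mul (reflSign i)).sub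
      (hasDerivAt_euclidean_apply (hf.deriv_y x (-y) hx) i).comp_neg') ?_
    have := hcol x y hx i 2
    simp only [PiLp.smul_apply, smul_eq_mul, Xbeta, col, hFun_neg]
    simp only [reflSign, Matrix.cons_val] at this ⊢
    linear_combination (2 * y / hFun x y) * this

theorem sub_radius_smul_fVec_eq (hf : IsCurvatureSurface F f) {x : ℝ} (hx : 0 < x)
    (y y' : ℝ) : f x y - radius x • fVec F x y = f x y' - radius x • fVec F x y' := by
  ext i
  refine eq_of_hasDerivAt_zero (g := fun t => (f x t - radius x • fVec F x t) i)
    (fun t => ?_) y y'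
  refine HasDerivAt.congr_deriv ((hasDerivAt_euclidean_apply (hf.deriv_y x t hx) i).sub
    (hf.frame.hasDerivAt_radius_smul_fVec_y hx t i)) ?_
  simp

end IsCurvatureSurface

theorem mainTheorem11 (F : ℝ → ℝ → Matrix (Fin 4) (Fin 4) ℝ) (f : ℝ → ℝ → E4)
    (hf : IsCurvatureSurface F f) (x₀ : ℝ) (hx₀ : 0 < x₀)
    (hf₀ : f x₀ 0 = 0) (hF₀ : F x₀ 0 = 1) :
    (∀ x y : ℝ, 0 < x →
      reflB (f x y) = f x (-y) ∧
      reflB (phi F x y) = -phi F x (-y) ∧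
      reflB (xi F x y) = xi F x (-y)) ∧
    ∃ u A : ℝ → E4, ∀ x : ℝ, 0 < x →
      (∀ y : ℝ, u x = uVec F x y) ∧
      (∀ y : ℝ, f x y = radius x • fVec F x y + A x) ∧
      ‖u x‖ = 1 ∧
      (∀ y : ℝ, inner ℝ (f x y - A x) (u x) = 0 ∧ f x y ∈ Metric.sphere (A x) (radius x)) ∧
      reflB (u x) = u x ∧
      reflB (A x) = A x := by
  have hF := hf.frame
  refine ⟨fun x y hx => ⟨hf.reflB_eq hx hx₀ hf₀ hF₀ y, ?_, ?_⟩,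
    -- The base point y = 0 is fixed by y ↦ -y, so invariance under B is immediate.
    fun x => uVec F x 0, fun x => f x 0 - radius x • fVec F x 0, fun x hx => ?_⟩
  · simp [phi, hF.reflB_col hx hx₀ hF₀, reflSign]
  · simp [xi, hF.reflB_col hx hx₀ hF₀, reflSign]
  have hA : ∀ y, f x y - (f x 0 - radius x • fVec F x 0) = radius x • fVec F x y := fun y => by
    rw [← hf.sub_radius_smul_fVec_eq hx y 0, sub_sub_cancel]
  refine ⟨fun y => hF.uVec_eq hx 0 y, fun y => sub_eq_iff_eq_add.1 (hA y), hF.norm_uVec hx 0,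
    fun y => ⟨?_, ?_⟩, ?_, ?_⟩
  · rw [hA]
    dsimp only
    rw [hF.uVec_eq hx 0 y, real_inner_smul_left, hF.inner_fVec_uVec hx, mul_zero]
  · rw [mem_sphere_iff_norm, hA, norm_smul, hF.norm_fVec hx, mul_one,
      Real.norm_of_nonneg (radius_nonneg x)]
  · rw [hF.reflB_uVec hx hx₀ hF₀, neg_zero]
  · rw [map_sub, map_smul, hf.reflB_eq hx hx₀ hf₀ hF₀, hF.reflB_fVec hx hx₀ hF₀, neg_zero]
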